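/- For every $\beta_0<1$ there exist constants $\alpha_0>0$ and $c>0$, depending only on $\beta_0$ (in particular absolute constants when, say, $\beta_0=1/2$), such that the following holds for all integers $d\ge 1$, $n\ge 0$ and all reals $R\ge 1$, $0<\alpha\le\alpha_0$, $0<\beta\le\beta_0$, $\varepsilon>0$. Let $M$ be a randomized algorithm that takes $n$ inputs in $\mathbb{R}^d$ and outputs a point of $\mathbb{R}^d$ (that is, a Markov kernel from $(\mathbb{R}^d)^n$ to $\mathbb{R}^d$). Suppose that (i) $M$ is $\varepsilon$-differentially private: for all $X,X'\in(\mathbb{R}^d)^n$ that agree at all but a single index and every measurable $S\subseteq\mathbb{R}^d$, $\Pr[M(X)\in S]\le e^{\varepsilon}\,\Pr[M(X')\in S]$; (ii) for every $\mu\in\mathbb{R}^d$ with Euclidean norm $\|\mu\|\le R$, if $X_1,\dots,X_n$ are independent samples from $\mathcal N(\mu,I)$, then with probability at least $1-\beta$ (over the samples and the randomness of $M$) the output $\hat\mu=M(X_1,\dots,X_n)$ satisfies $\|\hat\mu-\mu\|\le\alpha$. Then \[ n\;\ge\; c\left(\frac{d+\log(1/\beta)}{\alpha^2}+\frac{d+\log(1/\beta)}{\alpha\varepsilon}+\frac{d\log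 R+\log(1/\beta)}{\varepsilon}\right). \] -/

import Mathlib

open MeasureTheory ProbabilityTheory

/-- Pure differential privacy of a randomized algorithm that takes `n` inputs from `𝒳` and
outputs a random element of `𝒴`; `M X` is the law of the output on the dataset `X`.
Neighbouring datasets agree at all but a single index. -/
def IsPureDP {n : ℕ} {𝒳 𝒴 : Type*} [MeasurableSpace 𝒳] [MeasurableSpace 𝒴]
    (ε : ℝ) (M : Kernel (Fin n → 𝒳) 𝒴) : Prop :=
  ∀ (X X' : Fin n → 𝒳) (i : Fin n), (∀ j, j ≠ i → X j = X' j) →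
    ∀ S : Set 𝒴, MeasurableSet S → M X S ≤ ENNReal.ofReal (Real.exp ε) * M X' S

/-- For every `μ` with `‖μ‖ ≤ R`, given `n` independent samples from `N(μ, I)` on `ℝ^d`, the
output of `M` is within Euclidean distance `α` of `μ` with probability at least `1 - β`, over both
the samples and the randomness of `M`. -/
def EstimatesGaussianMean {n d : ℕ} (R α β : ℝ)
    (M : Kernel (Fin n → EuclideanSpace ℝ (Fin d)) (EuclideanSpace ℝ (Fin d))) : Prop :=
  ∀ μ : EuclideanSpace ℝ (Fin d), ‖μ‖ ≤ R →
    ENNReal.ofReal (1 - β) ≤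
      (Measure.pi fun _ : Fin n => multivariateGaussian μ (1 : Matrix (Fin d) (Fin d) ℝ)).bind M
        {y | ‖y - μ‖ ≤ α}

/-! Let `ν` be the output law on samples from `N(0, I)`, and `b = 1 - β₀`. Accuracy at `μ`, moved to
the null samples, forces `ν` to put mass at least `p` on the `α`-ball around every `μ` with `‖μ‖ ≤
r`. Three transfers give `p`: Cauchy–Schwarz with the likelihood ratio (`b² exp(-n r²)`), changing
all samples by privacy (`b exp(-n ε)`), and, for `ε, r ≤ 1`, changing samples one by one, where
privacy and the closeness of the two Gaussians multiply (`b exp(-3 n ε r)`).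

Two facts limit `p`: averaging over centres gives `p (r/α)^d ≤ 1`, hence the terms in `d`, and
disjointness of two balls gives `p ≤ β`, hence the terms in `log (1/β)`. The radius is of order `α`,
or `R` for the `log R` term. -/

open scoped ENNReal NNReal

/-! ### Second moments of Gaussian likelihood ratios -/

/-- `P` has a density with respect to `Q` whose second moment under `Q` is at most `D`. -/
def HasDensitySqBound {Ω : Type*} [MeasurableSpace Ω] (P Q : Measure Ω) (D : ℝ≥0∞) : Prop :=
  ∃ L : Ω → ℝ≥0∞, Measurable L ∧ P = Q.withDensity L ∧ ∫⁻ x, L x ^ 2 ∂Q ≤ D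

theorem lintegral_pi_prod {ι : Type*} [Fintype ι] {Ω : ι → Type*} [∀ i, MeasurableSpace (Ω i)]
    (Q : ∀ i, Measure (Ω i)) [∀ i, IsProbabilityMeasure (Q i)] {f : ∀ i, Ω i → ℝ≥0∞}
    (hf : ∀ i, Measurable (f i)) :
    ∫⁻ x, ∏ i, f i (x i) ∂Measure.pi Q = ∏ i, ∫⁻ x, f i x ∂Q i := by
  have hind : iIndepFun (fun i (x : ∀ i, Ω i) => f i (x i)) (Measure.pi Q) :=
    iIndepFun_pi fun i => (hf i).aemeasurable
  rw [lintegral_prod_eq_prod_lintegral_of_indepFun Finset.univ _ hind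
    fun i => (hf i).comp (measurable_pi_apply i)]
  refine Finset.prod_congr rfl fun i _ => ?_
  exact (measurePreserving_eval Q i).lintegral_comp (hf i)

theorem pi_withDensity {ι : Type*} [Fintype ι] {Ω : ι → Type*} [∀ i, MeasurableSpace (Ω i)]
    (P Q : ∀ i, Measure (Ω i)) [∀ i, IsProbabilityMeasure (P i)]
    [∀ i, IsProbabilityMeasure (Q i)] {L : ∀ i, Ω i → ℝ≥0∞} (hL : ∀ i, Measurable (L i))
    (hP : ∀ i, P i = (Q i).withDensity (L i)) :
    Measure.pi P = (Measure.pi Q).withDensity fun x => ∏ i, L i (x i) := by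
  refine Measure.pi_eq fun s hs => ?_
  rw [withDensity_apply _ (MeasurableSet.univ_pi hs),
    ← lintegral_indicator (MeasurableSet.univ_pi hs)]
  have h : ∀ x : ∀ i, Ω i, (Set.univ.pi s).indicator (fun x => ∏ i, L i (x i)) x =
      ∏ i, (s i).indicator (L i) (x i) := by
    intro x
    by_cases hx : x ∈ Set.univ.pi s
    · rw [Set.indicator_of_mem hx]
      exact Finset.prod_congr rfl fun i _ => (Set.indicator_of_mem (hx i trivial) _).symm
    · rw [Set.indicator_of_notMem hx]
      simp only [Set.mem_pi, Set.mem_univ, true_imp_iff, not_forall] at hx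
      obtain ⟨i, hi⟩ := hx
      exact (Finset.prod_eq_zero (Finset.mem_univ i) (Set.indicator_of_notMem hi _)).symm
  simp_rw [h]
  rw [lintegral_pi_prod Q fun i => (hL i).indicator (hs i)]
  refine Finset.prod_congr rfl fun i _ => ?_
  rw [lintegral_indicator (hs i), hP i, withDensity_apply _ (hs i)]

theorem HasDensitySqBound.pi {ι : Type*} [Fintype ι] {Ω : ι → Type*}
    [∀ i, MeasurableSpace (Ω i)] {P Q : ∀ i, Measure (Ω i)} [∀ i, IsProbabilityMeasure (P i)]
    [∀ i, IsProbabilityMeasure (Q i)] {D : ι → ℝ≥0∞}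
    (h : ∀ i, HasDensitySqBound (P i) (Q i) (D i)) :
    HasDensitySqBound (Measure.pi P) (Measure.pi Q) (∏ i, D i) := by
  choose L hL hP hD using h
  refine ⟨fun x => ∏ i, L i (x i),
    Finset.measurable_prod _ fun i _ => (hL i).comp (measurable_pi_apply i),
    pi_withDensity P Q hL hP, ?_⟩
  simp_rw [← Finset.prod_pow]
  rw [lintegral_pi_prod Q (f := fun i x => L i x ^ 2) fun i => (hL i).pow_const 2]
  exact Finset.prod_le_prod' fun i _ => hD i

theorem HasDensitySqBound.map_equiv {Ω Ω' : Type*} [MeasurableSpace Ω] [MeasurableSpace Ω']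
    {P Q : Measure Ω} {D : ℝ≥0∞} (h : HasDensitySqBound P Q D) (e : Ω ≃ᵐ Ω') :
    HasDensitySqBound (P.map e) (Q.map e) D := by
  obtain ⟨L, hL, rfl, hD⟩ := h
  refine ⟨L ∘ e.symm, hL.comp e.symm.measurable, ?_, ?_⟩
  · ext s hs
    rw [e.map_apply, withDensity_apply _ (e.measurable hs), withDensity_apply _ hs,
      setLIntegral_map hs (hL.comp e.symm.measurable) e.measurable]
    simp
  · rw [lintegral_map_equiv]
    simpa using hD

/-- The likelihood ratio is `exp(m x - m²/2)`; the Gaussian moment generating function at `2m` gives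
its second moment as `exp(-m² + 2m²)`. -/
theorem gaussianReal_hasDensitySqBound (m : ℝ) :
    HasDensitySqBound (gaussianReal m 1) (gaussianReal 0 1)
      (ENNReal.ofReal (Real.exp (m ^ 2))) := by
  refine ⟨fun x => ENNReal.ofReal (Real.exp (m * x - m ^ 2 / 2)), by fun_prop, ?_, ?_⟩
  · rw [gaussianReal_of_var_ne_zero _ one_ne_zero, gaussianReal_of_var_ne_zero _ one_ne_zero,
      ← withDensity_mul _ (measurable_gaussianPDF 0 1) (by fun_prop)]
    congr 1
    ext x
    simp only [gaussianPDF, gaussianPDFReal, Pi.mul_apply]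
    rw [← ENNReal.ofReal_mul (by positivity), mul_assoc _ (Real.exp _), ← Real.exp_add]
    congr 3
    push_cast
    ring
  · have h : ∀ x : ℝ, ENNReal.ofReal (Real.exp (m * x - m ^ 2 / 2)) ^ 2 =
        ENNReal.ofReal (Real.exp (-m ^ 2) * Real.exp ((2 * m) * x)) := by
      intro x
      rw [← ENNReal.ofReal_pow (by positivity), ← Real.exp_nat_mul, ← Real.exp_add]
      congr 2
      push_cast
      ring
    simp_rw [h]
    rw [← ofReal_integral_eq_lintegral_ofReal
      ((integrable_exp_mul_gaussianReal (2 * m)).const_mul _)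
      (Filter.Eventually.of_forall fun x => by positivity), integral_const_mul]
    have hm : ∫ x, Real.exp ((2 * m) * x) ∂gaussianReal 0 1 =
        Real.exp (0 * (2 * m) + ((1 : NNReal) : ℝ) * (2 * m) ^ 2 / 2) :=
      congrFun mgf_id_gaussianReal (2 * m)
    rw [hm, ← Real.exp_add]
    refine ENNReal.ofReal_le_ofReal (Real.exp_le_exp.2 (le_of_eq ?_))
    push_cast
    ring

open WithLp in
theorem multivariateGaussian_one_eq_map_pi {ι : Type*} [Fintype ι] [DecidableEq ι]
    (μ : EuclideanSpace ℝ ι) :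
    multivariateGaussian μ (1 : Matrix ι ι ℝ) =
      (Measure.pi fun i => gaussianReal (μ i) 1).map (MeasurableEquiv.toLp 2 (ι → ℝ)) := by
  apply Measure.ext_of_charFun (E := EuclideanSpace ℝ ι)
  ext t
  rw [charFun_multivariateGaussian Matrix.PosSemidef.one, MeasurableEquiv.coe_toLp, charFun_pi]
  simp_rw [charFun_gaussianReal, ← Complex.exp_sum]
  congr 1
  rw [Finset.sum_sub_distrib, ← Finset.sum_div, ← Finset.sum_mul]
  simp only [PiLp.inner_apply, Matrix.one_mulVec, dotProduct]
  simp [pow_two, mul_comm]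

theorem multivariateGaussian_hasDensitySqBound {d : ℕ} (μ : EuclideanSpace ℝ (Fin d)) :
    HasDensitySqBound (multivariateGaussian μ (1 : Matrix (Fin d) (Fin d) ℝ))
      (multivariateGaussian 0 (1 : Matrix (Fin d) (Fin d) ℝ))
      (ENNReal.ofReal (Real.exp (‖μ‖ ^ 2))) := by
  rw [multivariateGaussian_one_eq_map_pi, multivariateGaussian_one_eq_map_pi,
    EuclideanSpace.real_norm_sq_eq, Real.exp_sum,
    ENNReal.ofReal_prod_of_nonneg fun i _ => (Real.exp_pos _).le]
  exact (HasDensitySqBound.pi fun i => gaussianReal_hasDensitySqBound (μ i)).map_equiv _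

/-! ### Change of measure -/

/-- Cauchy–Schwarz for `∫ L f dQ`, together with `f² ≤ f`. -/
theorem HasDensitySqBound.sq_le_mul_lintegral {Ω : Type*} [MeasurableSpace Ω] {P Q : Measure Ω}
    {D b : ℝ≥0} (h : HasDensitySqBound P Q D) (hD : D ≠ 0) {f : Ω → ℝ≥0∞}
    (hf : Measurable f) (hf1 : ∀ x, f x ≤ 1) (hb0 : b ≠ 0) (hb : (b : ℝ≥0∞) ≤ ∫⁻ x, f x ∂P) :
    (b : ℝ≥0∞) ^ 2 ≤ D * ∫⁻ x, f x ∂Q := by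
  obtain ⟨L, hL, rfl, hLD⟩ := h
  rw [lintegral_withDensity_eq_lintegral_mul _ hL hf] at hb
  -- Expands `(D f - b L)² ≥ 0` using `f² ≤ f`; integrating this yields the bound without square
  -- roots.
  have hpt : ∀ x, 2 * D * b * (L * f) x ≤ D ^ 2 * f x + b ^ 2 * L x ^ 2 := by
    intro x
    have hfx := hf1 x
    rw [Pi.mul_apply]
    generalize L x = l at *
    generalize f x = t at *
    induction l with
    | top => simp [hb0]
    | coe l =>
      lift t to ℝ≥0 using ne_top_of_le_ne_top ENNReal.one_ne_top hfx
      norm_cast at hfx ⊢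
      have hD' : (0 : ℝ) ≤ D := D.2
      have ht : (t : ℝ) ≤ 1 := hfx
      have ht0 : (0 : ℝ) ≤ t := t.2
      rw [← NNReal.coe_le_coe]
      push_cast
      nlinarith [sq_nonneg ((D : ℝ) * t - b * l),
        mul_nonneg (sq_nonneg (D : ℝ)) (mul_nonneg ht0 (sub_nonneg.2 ht))]
  have hint : 2 * D * b * (b : ℝ≥0∞) ≤ D ^ 2 * ∫⁻ x, f x ∂Q + b ^ 2 * D := by
    calc 2 * D * b * (b : ℝ≥0∞) ≤ 2 * D * b * ∫⁻ x, (L * f) x ∂Q := by gcongr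
      _ = ∫⁻ x, 2 * D * b * (L * f) x ∂Q := by
        rw [lintegral_const_mul _ (hL.mul hf)]
      _ ≤ ∫⁻ x, (D ^ 2 * f x + b ^ 2 * L x ^ 2) ∂Q := lintegral_mono hpt
      _ = D ^ 2 * ∫⁻ x, f x ∂Q + b ^ 2 * ∫⁻ x, L x ^ 2 ∂Q := by
        rw [lintegral_add_left (hf.const_mul _), lintegral_const_mul _ hf,
          lintegral_const_mul _ (hL.pow_const 2)]
      _ ≤ _ := by gcongr
  generalize ∫⁻ x, f x ∂Q = I at hint
  induction I with
  | top => simp [hD]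
  | coe I =>
    norm_cast at hint ⊢
    have hD' : (0 : ℝ) < D := by exact_mod_cast pos_iff_ne_zero.2 hD
    rw [← NNReal.coe_le_coe] at hint ⊢
    push_cast at hint ⊢
    refine le_of_mul_le_mul_left ?_ hD'
    nlinarith

/-- Two probability measures with density close to one in mean square assign close integrals to
functions whose values agree up to a constant factor. -/
theorem HasDensitySqBound.lintegral_le_of_ratio_bounded {Ω : Type*} [MeasurableSpace Ω]
    {P Q : Measure Ω} [IsProbabilityMeasure P] [IsProbabilityMeasure Q] {D r δ : ℝ≥0}
    (h : HasDensitySqBound P Q D) (hr : r ≠ 0) (hD : D ≤ 1 + 2 * r ^ 2) {g : Ω → ℝ≥0∞}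
    (hg : Measurable g) (hg1 : ∀ x, g x ≠ ∞) (hratio : ∀ x y, g x ≤ (1 + δ : ℝ≥0) * g y) :
    ∫⁻ x, g x ∂P ≤ (1 + 3 / 2 * δ * r : ℝ≥0) * ∫⁻ x, g x ∂Q := by
  obtain ⟨L, hL, hP, hLD⟩ := h
  have hL1 : ∫⁻ x, L x ∂Q = 1 := by
    have := measure_univ (μ := P)
    rwa [hP, withDensity_apply _ MeasurableSet.univ, setLIntegral_univ] at this
  have hne : Nonempty Ω := nonempty_of_isProbabilityMeasure Q
  have hmg : ∀ x, ⨅ y, g y ≤ g x := fun x => iInf_le _ x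
  have hgm : ∀ x, g x ≤ (1 + δ : ℝ≥0) * ⨅ y, g y := by
    intro x
    rw [ENNReal.mul_iInf_of_ne (by simp) ENNReal.coe_ne_top]
    exact le_iInf fun y => hratio x y
  have hmtop : ⨅ y, g y ≠ ∞ := ne_top_of_le_ne_top (hg1 hne.some) (hmg _)
  lift (⨅ y, g y) to ℝ≥0 using hmtop with m
  have hm : (m : ℝ≥0∞) ≤ ∫⁻ x, g x ∂Q := by
    calc (m : ℝ≥0∞) = ∫⁻ _, m ∂Q := by simp
      _ ≤ _ := lintegral_mono hmg
  -- With `m = inf g`, the change of integral is `∫ (g - m)(L - 1) dQ`, where `0 ≤ g - m ≤ δ m`.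
  -- Then `2r(L - 1) ≤ r² + (L - 1)²`, and `∫ (L - 1)² dQ ≤ 2r²` gives the factor `3/2`. Terms are
  -- rearranged to avoid subtraction in `ℝ≥0∞`.
  have hpt : ∀ᵐ x ∂Q, 2 * r * (L * g) x + (2 * r * m + 2 * δ * m * L x) ≤
      2 * r * g x + (2 * r * m * L x + (δ * m * L x ^ 2 + δ * m * (r ^ 2 + 1))) := by
    filter_upwards [ae_lt_top hL (by simp [hL1])] with x hx
    have h1 := hmg x
    have h2 := hgm x
    have h3 := hg1 x
    rw [Pi.mul_apply]
    generalize L x = l at *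
    generalize g x = t at *
    lift l to ℝ≥0 using hx.ne
    lift t to ℝ≥0 using h3
    norm_cast at h1 h2 ⊢
    rw [← NNReal.coe_le_coe] at h1 h2 ⊢
    push_cast at h1 h2 ⊢
    have hr' : (0 : ℝ) ≤ r := r.2
    have hδ' : (0 : ℝ) ≤ δ := δ.2
    have hm' : (0 : ℝ) ≤ m := m.2
    have hδm := mul_nonneg hδ' hm'
    suffices H : 2 * r * ((t - m) * (l - 1)) ≤ δ * m * (r ^ 2 + (l - 1) ^ 2 : ℝ) by nlinarith
    rcases le_total (1 : ℝ) l with hl | hl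
    · have h4 : ((t : ℝ) - m) * (l - 1) ≤ δ * m * (l - 1) :=
        mul_le_mul_of_nonneg_right (by linarith) (by linarith)
      nlinarith [mul_nonneg hδm (sq_nonneg ((r : ℝ) - (l - 1))), mul_le_mul_of_nonneg_left h4 hr']
    · have h4 : ((t : ℝ) - m) * (l - 1) ≤ 0 :=
        mul_nonpos_of_nonneg_of_nonpos (by linarith) (by linarith)
      have h5 : 0 ≤ δ * m * (r ^ 2 + (l - 1) ^ 2 : ℝ) := by positivity
      nlinarith [mul_nonpos_of_nonneg_of_nonpos hr' h4]
  have hint := lintegral_mono_ae hpt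
  rw [lintegral_add_left ((hL.mul hg).const_mul _), lintegral_const_mul _ (hL.mul hg),
    lintegral_add_left measurable_const, lintegral_const_mul _ hL,
    lintegral_add_left (hg.const_mul _), lintegral_const_mul _ hg,
    lintegral_add_left (hL.const_mul _), lintegral_const_mul _ hL,
    lintegral_add_left ((hL.pow_const 2).const_mul _), lintegral_const_mul _ (hL.pow_const 2),
    lintegral_const, lintegral_const, measure_univ, hL1,
    ← lintegral_withDensity_eq_lintegral_mul _ hL hg, ← hP] at hint
  generalize ∫⁻ x, L x ^ 2 ∂Q = J at *
  lift J to ℝ≥0 using ne_top_of_le_ne_top ENNReal.coe_ne_top hLD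
  generalize ∫⁻ x, g x ∂Q = I at *
  generalize ∫⁻ x, g x ∂P = I' at *
  induction I with
  | top => simp
  | coe I =>
    have hI' : I' ≠ ∞ := by
      rintro rfl
      rw [ENNReal.mul_top (by simpa using hr), top_add, top_le_iff] at hint
      exact ENNReal.coe_ne_top (r := 2 * r * I + (2 * r * m * 1 +
        (δ * m * J + δ * m * (r ^ 2 + 1) * 1))) (by exact_mod_cast hint)
    lift I' to ℝ≥0 using hI'
    norm_cast at hint hm hLD ⊢
    rw [← NNReal.coe_le_coe] at hint hm hLD hD ⊢
    push_cast at hint hm hLD hD ⊢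
    have hr' : (0 : ℝ) < r := by exact_mod_cast pos_iff_ne_zero.2 hr
    have hδ' : (0 : ℝ) ≤ δ := δ.2
    have hm' : (0 : ℝ) ≤ m := m.2
    have h1 : δ * m * J ≤ δ * m * (1 + 2 * r ^ 2 : ℝ) := by gcongr; linarith
    have h2 : δ * r ^ 2 * m ≤ δ * r ^ 2 * (I : ℝ) := by gcongr
    refine le_of_mul_le_mul_left ?_ hr'
    nlinarith

/-- A factor by which integrals of functions of one coordinate change, tensorized to functions on a
product for which changing one coordinate changes the value by at most a constant factor. -/
theorem lintegral_pi_le_of_ratio_bounded {Ω : Type*} [MeasurableSpace Ω] {P Q : Measure Ω}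
    [IsProbabilityMeasure P] [IsProbabilityMeasure Q] {E κ : ℝ≥0∞}
    (hκ : ∀ g : Ω → ℝ≥0∞, Measurable g → (∀ x, g x ≤ 1) → (∀ x y, g x ≤ E * g y) →
      ∫⁻ x, g x ∂P ≤ κ * ∫⁻ x, g x ∂Q) :
    ∀ {n : ℕ} {f : (Fin n → Ω) → ℝ≥0∞}, Measurable f → (∀ X, f X ≤ 1) →
      (∀ (X X' : Fin n → Ω) (i : Fin n), (∀ j, j ≠ i → X j = X' j) → f X ≤ E * f X') →
      ∫⁻ X, f X ∂Measure.pi (fun _ => P) ≤ κ ^ n * ∫⁻ X, f X ∂Measure.pi (fun _ => Q)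
  | 0, f, _, _, _ => by
    rw [Measure.pi_of_empty, Measure.pi_of_empty]
    simp
  | n + 1, f, hf, hf1, hE => by
    have hsplit : ∀ (ρ : Measure Ω) [IsProbabilityMeasure ρ],
        ∫⁻ X, f X ∂Measure.pi (fun _ => ρ) =
          ∫⁻ X : Fin n → Ω, (∫⁻ x, f (Fin.cons x X) ∂ρ) ∂Measure.pi (fun _ => ρ) := by
      intro ρ _
      have hmp := (measurePreserving_piFinSuccAbove (fun _ : Fin (n + 1) => ρ) 0).symm
      rw [← hmp.lintegral_comp hf]
      refine (lintegral_prod_symm' _ (hf.comp (MeasurableEquiv.measurable _))).trans ?_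
      simp [Fin.insertNthEquiv]
    have hcons : Measurable fun z : (Fin n → Ω) × Ω => f (Fin.cons z.2 z.1) := by
      refine hf.comp (measurable_pi_iff.2 fun i => ?_)
      refine Fin.cases ?_ (fun i => ?_) i
      · simpa using measurable_snd
      · simp only [Fin.cons_succ]
        fun_prop
    have hh : Measurable fun X : Fin n → Ω => ∫⁻ x, f (Fin.cons x X) ∂Q :=
      hcons.lintegral_prod_right'
    have hstep : ∀ X : Fin n → Ω,
        ∫⁻ x, f (Fin.cons x X) ∂P ≤ κ * ∫⁻ x, f (Fin.cons x X) ∂Q := by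
      intro X
      refine hκ _ (hcons.comp measurable_prodMk_left) (fun x => hf1 _) fun x y => hE _ _ 0 ?_
      intro j hj
      obtain ⟨k, rfl⟩ := Fin.exists_succ_eq.2 hj
      simp
    -- Averaging out the first coordinate under `Q` preserves both the bound by one and the ratio
    -- bound in the remaining coordinates.
    have hrec := lintegral_pi_le_of_ratio_bounded hκ hh
      (fun X => by
        calc ∫⁻ x, f (Fin.cons x X) ∂Q ≤ ∫⁻ _, 1 ∂Q := lintegral_mono fun x => hf1 _
          _ = 1 := by simp)
      (fun X X' i hX => by
        have hX' : Measurable fun x => f (Fin.cons x X') := hcons.comp measurable_prodMk_left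
        rw [← lintegral_const_mul E hX']
        refine lintegral_mono fun x => hE _ _ i.succ fun j => ?_
        refine Fin.cases (by simp) (fun k hk => ?_) j
        simpa using hX k fun h => hk (by rw [h]))
    rw [hsplit P, hsplit Q]
    calc ∫⁻ X, ∫⁻ x, f (Fin.cons x X) ∂P ∂Measure.pi (fun _ : Fin n => P)
        ≤ ∫⁻ X, κ * ∫⁻ x, f (Fin.cons x X) ∂Q ∂Measure.pi (fun _ : Fin n => P) :=
          lintegral_mono hstep
      _ = κ * ∫⁻ X, ∫⁻ x, f (Fin.cons x X) ∂Q ∂Measure.pi (fun _ : Fin n => P) :=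
          lintegral_const_mul _ hh
      _ ≤ κ * (κ ^ n * ∫⁻ X, ∫⁻ x, f (Fin.cons x X) ∂Q ∂Measure.pi (fun _ : Fin n => Q)) := by
          gcongr
      _ = _ := by rw [pow_succ', mul_assoc]

/-! ### Upper limits on the mass of balls -/

/-- A continuous packing argument: by Fubini, the integral over all centres `μ` of the mass of the
`α`-ball at `μ` is the volume of one `α`-ball, and it is at least `p` times the volume of the
`r`-ball. -/
theorem mul_div_pow_le_one_of_forall_le_measure_ball {d : ℕ}
    (ν : Measure (EuclideanSpace ℝ (Fin d))) [IsProbabilityMeasure ν] {p r α : ℝ} (hp : 0 ≤ p)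
    (hα : 0 < α) (hr : 0 < r)
    (h : ∀ μ : EuclideanSpace ℝ (Fin d), ‖μ‖ ≤ r → ENNReal.ofReal p ≤ ν {y | ‖y - μ‖ ≤ α}) :
    p * (r / α) ^ d ≤ 1 := by
  let V : Measure (EuclideanSpace ℝ (Fin d)) := volume
  let T : Set (EuclideanSpace ℝ (Fin d) × EuclideanSpace ℝ (Fin d)) := {z | ‖z.2 - z.1‖ ≤ α}
  have hT : MeasurableSet T := measurableSet_le (by fun_prop) measurable_const
  have h1 : ENNReal.ofReal p * V (Metric.closedBall 0 r) ≤ (V.prod ν) T := by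
    rw [Measure.prod_apply hT]
    calc ENNReal.ofReal p * V (Metric.closedBall 0 r)
        = ∫⁻ _ in Metric.closedBall 0 r, ENNReal.ofReal p ∂V := by rw [setLIntegral_const]
      _ ≤ ∫⁻ μ in Metric.closedBall 0 r, ν (Prod.mk μ ⁻¹' T) ∂V :=
          setLIntegral_mono' Metric.isClosed_closedBall.measurableSet
            fun μ hμ => h μ (by simpa using hμ)
      _ ≤ _ := setLIntegral_le_lintegral _ _
  have h2 : (V.prod ν) T = V (Metric.closedBall 0 α) := by
    rw [Measure.prod_apply_symm hT]
    have : ∀ y, V ((fun x => (x, y)) ⁻¹' T) = V (Metric.closedBall 0 α) := by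
      intro y
      rw [← Measure.addHaar_closedBall_center V y]
      congr 1
      ext x
      simp [T, dist_eq_norm, norm_sub_rev]
    simp [this]
  have h3 : V (Metric.closedBall 0 r) =
      ENNReal.ofReal ((r / α) ^ d) * V (Metric.closedBall 0 α) := by
    have := Measure.addHaar_closedBall_mul_of_pos V 0 (div_pos hr hα) α
    rwa [div_mul_cancel₀ _ hα.ne', finrank_euclideanSpace_fin] at this
  have hV0 : V (Metric.closedBall 0 α) ≠ 0 := (Metric.measure_closedBall_pos V 0 hα).ne'
  have hVt : V (Metric.closedBall 0 α) ≠ ∞ := measure_closedBall_lt_top.ne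
  rw [h2, h3, ← mul_assoc, ← ENNReal.ofReal_mul hp] at h1
  rw [← ENNReal.ofReal_le_one]
  refine (ENNReal.mul_le_mul_iff_left hV0 hVt).1 ?_
  rwa [one_mul]

/-- A ball centred at distance `r > 2α` from the origin misses the ball at the origin, which leaves
it mass at most `β`. -/
theorem le_of_forall_le_measure_ball_of_two_mul_lt {d : ℕ} (hd : 1 ≤ d)
    (ν : Measure (EuclideanSpace ℝ (Fin d))) [IsProbabilityMeasure ν] {p r α β : ℝ}
    (hα : 0 < α) (hβ : 0 ≤ β) (hβ1 : β ≤ 1) (hr : 2 * α < r)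
    (h0 : ENNReal.ofReal (1 - β) ≤ ν {y | ‖y - 0‖ ≤ α})
    (h : ∀ μ : EuclideanSpace ℝ (Fin d), ‖μ‖ ≤ r → ENNReal.ofReal p ≤ ν {y | ‖y - μ‖ ≤ α}) :
    p ≤ β := by
  have hr0 : 0 ≤ r := by linarith
  let μ : EuclideanSpace ℝ (Fin d) := EuclideanSpace.single ⟨0, hd⟩ r
  have hμ : ‖μ‖ = r := by simp [μ, abs_of_nonneg hr0]
  have hdisj : Disjoint {y : EuclideanSpace ℝ (Fin d) | ‖y - 0‖ ≤ α} {y | ‖y - μ‖ ≤ α} := by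
    refine Set.disjoint_left.2 fun y (h1 : ‖y - 0‖ ≤ α) (h2 : ‖y - μ‖ ≤ α) => ?_
    have := norm_sub_le (y - 0) (y - μ)
    rw [show y - 0 - (y - μ) = μ by abel, hμ] at this
    linarith
  have hS : MeasurableSet {y : EuclideanSpace ℝ (Fin d) | ‖y - μ‖ ≤ α} :=
    measurableSet_le (by fun_prop) measurable_const
  have hsum : ENNReal.ofReal (1 - β) + ENNReal.ofReal p ≤ 1 :=
    calc _ ≤ ν {y | ‖y - 0‖ ≤ α} + ν {y | ‖y - μ‖ ≤ α} := add_le_add h0 (h μ hμ.le)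
      _ = ν ({y | ‖y - 0‖ ≤ α} ∪ {y | ‖y - μ‖ ≤ α}) := (measure_union hdisj hS).symm
      _ ≤ 1 := prob_le_one
  rcases le_total p 0 with hp | hp
  · exact hp.trans hβ
  · rw [← ENNReal.ofReal_add (by linarith) hp, ENNReal.ofReal_le_one] at hsum
    linarith

/-! ### Lower bounds on the mass near each mean -/

section LowerBounds

variable {n d : ℕ} {M : Kernel (Fin n → EuclideanSpace ℝ (Fin d)) (EuclideanSpace ℝ (Fin d))}
  {R α β b : ℝ}

theorem measurableSet_norm_sub_le (μ : EuclideanSpace ℝ (Fin d)) (α : ℝ) :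
    MeasurableSet {y | ‖y - μ‖ ≤ α} :=
  measurableSet_le (by fun_prop) measurable_const

theorem ofReal_mul_exp_neg_le {a x : ℝ} {t : ℝ≥0∞} (ha : 0 ≤ a)
    (h : ENNReal.ofReal a ≤ ENNReal.ofReal (Real.exp x) * t) :
    ENNReal.ofReal (a * Real.exp (-x)) ≤ t := by
  rw [ENNReal.ofReal_mul ha]
  calc _ ≤ ENNReal.ofReal (Real.exp x) * t * ENNReal.ofReal (Real.exp (-x)) := by gcongr
    _ = ENNReal.ofReal (Real.exp x * Real.exp (-x)) * t := by
      rw [ENNReal.ofReal_mul (Real.exp_pos _).le]; ring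
    _ = t := by rw [← Real.exp_add]; simp

theorem EstimatesGaussianMean.le_lintegral (h : EstimatesGaussianMean R α β M) (hβ : β ≤ 1 - b)
    {μ : EuclideanSpace ℝ (Fin d)} (hμ : ‖μ‖ ≤ R) :
    ENNReal.ofReal b ≤ ∫⁻ X, M X {y | ‖y - μ‖ ≤ α}
      ∂Measure.pi fun _ : Fin n => multivariateGaussian μ (1 : Matrix (Fin d) (Fin d) ℝ) := by
  rw [← Measure.bind_apply (measurableSet_norm_sub_le μ α) M.aemeasurable]
  exact (ENNReal.ofReal_le_ofReal (by linarith)).trans (h μ hμ)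

/-- The chance of landing near `μ` on samples from the standard Gaussian, bounded below through the
second moment of the likelihood ratio. -/
theorem EstimatesGaussianMean.sq_mul_exp_le_bind [IsMarkovKernel M]
    (h : EstimatesGaussianMean R α β M) (hb : 0 < b) (hβ : β ≤ 1 - b) {r : ℝ} (hr : r ≤ R)
    (μ : EuclideanSpace ℝ (Fin d)) (hμ : ‖μ‖ ≤ r) :
    ENNReal.ofReal (b ^ 2 * Real.exp (-(n * r ^ 2))) ≤
      (Measure.pi fun _ : Fin n => multivariateGaussian 0 (1 : Matrix (Fin d) (Fin d) ℝ)).bind M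
        {y | ‖y - μ‖ ≤ α} := by
  have hS := measurableSet_norm_sub_le μ α
  have hden := HasDensitySqBound.pi fun _ : Fin n => multivariateGaussian_hasDensitySqBound μ
  rw [Finset.prod_const, Finset.card_univ, Fintype.card_fin,
    ← ENNReal.ofReal_pow (Real.exp_pos _).le, ← Real.exp_nat_mul] at hden
  have hsq := hden.sq_le_mul_lintegral (D := (Real.exp (n * ‖μ‖ ^ 2)).toNNReal)
    (by simpa using Real.exp_pos _) (M.measurable_coe hS) (fun X => prob_le_one)
    (b := b.toNNReal) (by simpa using hb) (h.le_lintegral hβ (hμ.trans hr))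
  rw [Measure.bind_apply hS M.aemeasurable]
  refine ofReal_mul_exp_neg_le (by positivity) ?_
  rw [ENNReal.ofReal_pow hb.le]
  refine hsq.trans ?_
  refine mul_le_mul_left (ENNReal.ofReal_le_ofReal (Real.exp_le_exp.2 ?_)) _
  gcongr

/-- The chance of landing near `μ` on samples from the standard Gaussian, bounded below by changing
every sample. -/
theorem EstimatesGaussianMean.mul_exp_le_bind [IsMarkovKernel M]
    (h : EstimatesGaussianMean R α β M) {ε : ℝ} (hM : IsPureDP ε M) (hb : 0 < b)
    (hβ : β ≤ 1 - b) (μ : EuclideanSpace ℝ (Fin d)) (hμ : ‖μ‖ ≤ R) :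
    ENNReal.ofReal (b * Real.exp (-(n * ε))) ≤
      (Measure.pi fun _ : Fin n => multivariateGaussian 0 (1 : Matrix (Fin d) (Fin d) ℝ)).bind M
        {y | ‖y - μ‖ ≤ α} := by
  have hS := measurableSet_norm_sub_le μ α
  rw [Measure.bind_apply hS M.aemeasurable]
  refine ofReal_mul_exp_neg_le hb.le ((h.le_lintegral hβ hμ).trans ?_)
  rw [Real.exp_nat_mul, ENNReal.ofReal_pow (Real.exp_pos _).le]
  refine lintegral_pi_le_of_ratio_bounded (E := ENNReal.ofReal (Real.exp ε)) ?_
    (M.measurable_coe hS) (fun X => prob_le_one) fun X X' i hX => hM X X' i hX _ hS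
  intro g hg _ hratio
  -- The ratio bound alone compares integrals under any two probability measures, so each sample
  -- costs `exp ε` however far away `μ` is.
  have hy : ∀ y, ∫⁻ x, g x ∂multivariateGaussian μ (1 : Matrix (Fin d) (Fin d) ℝ) ≤
      ENNReal.ofReal (Real.exp ε) * g y := fun y =>
    calc _ ≤ ∫⁻ _, ENNReal.ofReal (Real.exp ε) * g y
          ∂multivariateGaussian μ (1 : Matrix (Fin d) (Fin d) ℝ) :=
        lintegral_mono fun x => hratio x y
      _ = _ := by simp
  rw [← lintegral_const_mul _ hg]
  calc _ = ∫⁻ _, (∫⁻ x, g x ∂multivariateGaussian μ (1 : Matrix (Fin d) (Fin d) ℝ))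
        ∂multivariateGaussian 0 (1 : Matrix (Fin d) (Fin d) ℝ) := by simp
    _ ≤ _ := lintegral_mono hy

/-- The chance of landing near `μ` on samples from the standard Gaussian, bounded below by changing
the samples one at a time. -/
theorem EstimatesGaussianMean.mul_exp_mul_le_bind [IsMarkovKernel M]
    (h : EstimatesGaussianMean R α β M) {ε : ℝ} (hε : 0 < ε) (hε1 : ε ≤ 1) (hM : IsPureDP ε M)
    (hb : 0 < b) (hβ : β ≤ 1 - b) {r : ℝ} (hr0 : 0 < r) (hr1 : r ≤ 1) (hr : r ≤ R)
    (μ : EuclideanSpace ℝ (Fin d)) (hμ : ‖μ‖ ≤ r) :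
    ENNReal.ofReal (b * Real.exp (-(n * (3 * ε * r)))) ≤
      (Measure.pi fun _ : Fin n => multivariateGaussian 0 (1 : Matrix (Fin d) (Fin d) ℝ)).bind M
        {y | ‖y - μ‖ ≤ α} := by
  have hS := measurableSet_norm_sub_le μ α
  rw [Measure.bind_apply hS M.aemeasurable]
  refine ofReal_mul_exp_neg_le hb.le ((h.le_lintegral hβ (hμ.trans hr)).trans ?_)
  rw [Real.exp_nat_mul, ENNReal.ofReal_pow (Real.exp_pos _).le]
  refine lintegral_pi_le_of_ratio_bounded (E := ENNReal.ofReal (Real.exp ε)) ?_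
    (M.measurable_coe hS) (fun X => prob_le_one) fun X X' i hX => hM X X' i hX _ hS
  intro g hg hg1 hratio
  -- Used for the second moment, `exp(‖μ‖²) ≤ 1 + 2r²`, and for privacy, `exp ε ≤ 1 + 2ε`, so `δ =
  -- 2ε` and the factor per sample is `1 + 3εr ≤ exp(3εr)`.
  have hexp : ∀ x : ℝ, 0 ≤ x → x ≤ 1 → Real.exp x ≤ 1 + 2 * x := fun x hx0 hx1 => by
    have := Real.abs_exp_sub_one_le (x := x) (by rwa [abs_of_nonneg hx0])
    rw [abs_of_nonneg hx0] at this
    linarith [le_abs_self (Real.exp x - 1)]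
  have hsq : ‖μ‖ ^ 2 ≤ r ^ 2 := by gcongr
  have hr2 : r ^ 2 ≤ 1 := by nlinarith
  have hD : (Real.exp (‖μ‖ ^ 2)).toNNReal ≤ 1 + 2 * r.toNNReal ^ 2 := by
    rw [← NNReal.coe_le_coe]
    push_cast
    rw [Real.coe_toNNReal _ (Real.exp_pos _).le, Real.coe_toNNReal _ hr0.le]
    linarith [hexp (‖μ‖ ^ 2) (by positivity) (by linarith)]
  have hone := (multivariateGaussian_hasDensitySqBound μ).lintegral_le_of_ratio_bounded
    (D := (Real.exp (‖μ‖ ^ 2)).toNNReal) (r := r.toNNReal) (δ := (2 * ε).toNNReal)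
    (by simpa using hr0) hD hg (fun x => ne_top_of_le_ne_top ENNReal.one_ne_top (hg1 x))
    (fun x y => by
      refine (hratio x y).trans (mul_le_mul_left ?_ _)
      refine ENNReal.coe_le_coe.2 (Real.toNNReal_le_iff_le_coe.2 ?_)
      push_cast
      rw [Real.coe_toNNReal _ (by positivity)]
      exact hexp ε hε.le hε1)
  refine hone.trans (mul_le_mul_left ?_ _)
  refine ENNReal.coe_le_coe.2 ?_
  rw [← NNReal.coe_le_coe, Real.coe_toNNReal _ (Real.exp_pos _).le]
  push_cast
  rw [Real.coe_toNNReal _ (by positivity), Real.coe_toNNReal _ hr0.le]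
  linarith [Real.add_one_le_exp (3 * ε * r)]

end LowerBounds

/-! ### Combining the bounds -/

theorem mul_log_add_log_le_of_mul_exp_neg_mul_pow_le_one {a y z : ℝ} {d : ℕ} (ha : 0 < a)
    (hz : 0 < z) (h : a * Real.exp (-y) * z ^ d ≤ 1) : d * Real.log z + Real.log a ≤ y := by
  have h1 := Real.log_le_log (by positivity) h
  rw [Real.log_mul (by positivity) (by positivity), Real.log_mul ha.ne' (by positivity),
    Real.log_exp, Real.log_pow, Real.log_one] at h1
  linarith

theorem log_one_div_le_of_mul_exp_neg_le {a y β : ℝ} (ha : 0 < a)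
    (h : a * Real.exp (-y) ≤ β) : Real.log (1 / β) ≤ y - Real.log a := by
  have h1 := Real.log_le_log (by positivity) h
  rw [Real.log_mul ha.ne' (by positivity), Real.log_exp] at h1
  rw [one_div, Real.log_inv]
  linarith

theorem sample_size_bound {b K R α ε n d ℓ : ℝ} (hb : 0 < b) (hb1 : b < 1)
    (hK : K = 3 / b ^ 2) (hd : 1 ≤ d) (hn : 0 ≤ n) (hR : 1 ≤ R) (hα : 0 < α) (hαK : α ≤ 1 / K)
    (hε : 0 < ε) (hℓ : 0 ≤ ℓ)
    (hdn : d * Real.log K + Real.log (b ^ 2) ≤ n * (K * α) ^ 2)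
    (hℓn : ℓ ≤ n * (3 * α) ^ 2 - Real.log (b ^ 2))
    (hRn : d * Real.log (R / α) + Real.log b ≤ n * ε)
    (hdε : ε ≤ 1 → d * Real.log K + Real.log b ≤ n * (3 * ε * (K * α)))
    (hℓε : ε ≤ 1 → ℓ ≤ n * (3 * ε * (3 * α)) - Real.log b) :
    (d + ℓ) / α ^ 2 + (d + ℓ) / (α * ε) + (d * Real.log R + ℓ) / ε ≤
      (3 * (K ^ 2 + 9 - 2 * Real.log b * K ^ 2 + (3 * K + 9 - 3 * K * Real.log b)) + 1) * n := by
  have hB : Real.log b < 0 := Real.log_neg hb hb1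
  have hK3 : 3 ≤ K := by
    rw [hK, le_div_iff₀ (by positivity)]
    nlinarith
  have hα1 : α ≤ 1 := hαK.trans (by rw [div_le_one (by linarith)]; linarith)
  have hlogb : Real.log (b ^ 2) = 2 * Real.log b := by simp
  -- The reason for `K = 3 / b²`: since `d ≥ 1`, the surplus `-2 d log b` in `d log K` absorbs `log
  -- (b²)` and leaves at least `d`.
  have hlogK : 1 - 2 * Real.log b ≤ Real.log K := by
    have h3 : 1 ≤ Real.log 3 := by
      rw [Real.le_log_iff_exp_le (by norm_num)]
      linarith [Real.exp_one_lt_d9]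
    rw [hK, Real.log_div (by norm_num) (by positivity), hlogb]
    linarith
  have hlogα : Real.log K ≤ -Real.log α := by
    have := Real.log_le_log hα hαK
    rw [one_div, Real.log_inv] at this
    linarith
  rw [hlogb] at hdn hℓn
  rw [Real.log_div (by linarith) hα.ne'] at hRn
  have hdK : d * (1 - 2 * Real.log b) ≤ d * Real.log K := by gcongr
  have hdB : 0 ≤ (d - 1) * -Real.log b := mul_nonneg (by linarith) (by linarith)
  have hnα : 0 ≤ n * α ^ 2 := by positivity
  have hnαε : 0 ≤ n * (α * ε) := by positivity
  have hd1 : d ≤ K ^ 2 * (n * α ^ 2) := by linarith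
  -- Since `d ≥ 1`, this turns the additive constant `-2 log b` in the bound on `ℓ` into a multiple
  -- of `n α²`.
  have hdB1 : d * -Real.log b ≤ K ^ 2 * (n * α ^ 2) * -Real.log b :=
    mul_le_mul_of_nonneg_right hd1 (by linarith)
  set C₁ := K ^ 2 + 9 - 2 * Real.log b * K ^ 2 with hC₁
  set C₂ := 3 * K + 9 - 3 * K * Real.log b with hC₂
  have hC₁0 : 0 ≤ C₁ := by linarith [sq_nonneg K, mul_nonneg (sq_nonneg K) (neg_nonneg.2 hB.le)]
  have hC₂0 : 0 ≤ C₂ := by linarith [mul_nonneg (by linarith : 0 ≤ K) (neg_nonneg.2 hB.le)]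
  have hsum1 : d + ℓ ≤ C₁ * n * α ^ 2 := by rw [hC₁]; linarith
  have hfirst : (d + ℓ) / α ^ 2 ≤ (C₁ + C₂) * n := by
    rw [div_le_iff₀ (by positivity)]
    linarith [mul_nonneg hC₂0 hnα]
  have hsecond : (d + ℓ) / (α * ε) ≤ (C₁ + C₂) * n := by
    rw [div_le_iff₀ (by positivity)]
    rcases le_total ε 1 with hε1 | hε1
    · have hdε := hdε hε1
      have hℓε := hℓε hε1
      have hd2 : d ≤ 3 * K * (n * (α * ε)) := by linarith
      have hdB2 : d * -Real.log b ≤ 3 * K * (n * (α * ε)) * -Real.log b :=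
        mul_le_mul_of_nonneg_right hd2 (by linarith)
      have hsum2 : d + ℓ ≤ C₂ * n * (α * ε) := by rw [hC₂]; linarith
      linarith [mul_nonneg hC₁0 hnαε]
    -- For `ε ≥ 1` the second term is dominated by the first.
    · have h1 : α ^ 2 ≤ α * ε := by rw [pow_two]; gcongr; linarith
      have h2 : C₁ * n * α ^ 2 ≤ C₁ * n * (α * ε) := by gcongr
      linarith [mul_nonneg hC₂0 hnαε]
  have hthird : (d * Real.log R + ℓ) / ε ≤ (C₁ + C₂ + 1) * n := by
    -- `α ≤ 1/K` makes `-d log α` outweigh `log b`.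
    have h1 : d * Real.log R / ε ≤ n := by
      rw [div_le_iff₀ hε]
      linarith [hdK, hdB, mul_le_mul_of_nonneg_left hlogα (by linarith : 0 ≤ d)]
    have h2 : ℓ / ε ≤ (d + ℓ) / (α * ε) := by
      gcongr
      · linarith
      · exact mul_le_of_le_one_left hε.le hα1
    rw [add_div]
    linarith
  linarith

theorem mainTheorem9 (β₀ : ℝ) (hβ₀ : β₀ < 1) :
    ∃ α₀ > (0 : ℝ), ∃ c > (0 : ℝ),
      ∀ (d n : ℕ) (R α β ε : ℝ)
        (M : Kernel (Fin n → EuclideanSpace ℝ (Fin d)) (EuclideanSpace ℝ (Fin d)))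
        [IsMarkovKernel M],
        1 ≤ d → 1 ≤ R → 0 < α → α ≤ α₀ → 0 < β → β ≤ β₀ → 0 < ε →
        IsPureDP ε M → EstimatesGaussianMean R α β M →
        c * ((d + Real.log (1 / β)) / α ^ 2 + (d + Real.log (1 / β)) / (α * ε) +
            (d * Real.log R + Real.log (1 / β)) / ε) ≤ n := by
  -- For `β₀ ≤ 0` no `β` is admissible; otherwise `b < 1`, so `log b < 0`.
  rcases le_or_gt β₀ 0 with hneg | hpos
  · exact ⟨1, one_pos, 1, one_pos, fun d n R α β ε M _ _ _ _ _ hβ hββ₀ => by linarith⟩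
  obtain ⟨b, hbdef⟩ : ∃ b, b = 1 - β₀ := ⟨_, rfl⟩
  have hb : 0 < b := by linarith
  have hb1 : b < 1 := by linarith
  obtain ⟨K, hK⟩ : ∃ K, K = 3 / b ^ 2 := ⟨_, rfl⟩
  have hK3 : 3 ≤ K := by
    rw [hK, le_div_iff₀ (by positivity)]
    nlinarith
  have hK0 : 0 < K := by linarith
  have hB : Real.log b < 0 := Real.log_neg hb hb1
  let C := 3 * (K ^ 2 + 9 - 2 * Real.log b * K ^ 2 + (3 * K + 9 - 3 * K * Real.log b)) + 1
  have hC : 0 < C := by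
    have h1 := mul_nonneg (sq_nonneg K) (neg_nonneg.2 hB.le)
    have h2 := mul_nonneg hK0.le (neg_nonneg.2 hB.le)
    simp only [C]
    nlinarith
  -- `α ≤ 1/K` gives `3α ≤ Kα ≤ 1 ≤ R`, so both small radii are admissible.
  refine ⟨1 / K, by positivity, 1 / C, by positivity, ?_⟩
  intro d n R α β ε M _ hd hR hα hαK hβ hββ₀ hε hDP hM
  have hβb : β ≤ 1 - b := by linarith
  have hKα : K * α ≤ 1 := by rwa [le_div_iff₀' hK0] at hαK
  have hKα0 : 0 < K * α := by positivity
  have h3α : 3 * α ≤ 1 := by nlinarith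
  rw [one_div, inv_mul_le_iff₀ hC]
  let ν := (Measure.pi fun _ : Fin n =>
    multivariateGaussian 0 (1 : Matrix (Fin d) (Fin d) ℝ)).bind M
  have hν : IsProbabilityMeasure ν := inferInstance
  have hν0 : ENNReal.ofReal (1 - β) ≤ ν {y | ‖y - 0‖ ≤ α} := hM 0 (by simpa using by linarith)
  have hKdiv : K * α / α = K := by field_simp
  -- The averaging bounds use radius `Kα`, or `R` with full privacy; the disjointness bounds use
  -- `3α`, where any fixed multiple above `2α` would serve.
  refine sample_size_bound hb hb1 hK (by exact_mod_cast hd) n.cast_nonneg hR hα hαK hε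
    (Real.log_nonneg (by rw [le_div_iff₀ hβ]; linarith)) ?_ ?_ ?_ ?_ ?_
  · have := mul_div_pow_le_one_of_forall_le_measure_ball ν (by positivity) hα hKα0
      (hM.sq_mul_exp_le_bind hb hβb (hKα.trans hR))
    rw [hKdiv] at this
    exact mul_log_add_log_le_of_mul_exp_neg_mul_pow_le_one (by positivity) hK0 this
  · exact log_one_div_le_of_mul_exp_neg_le (by positivity)
      (le_of_forall_le_measure_ball_of_two_mul_lt hd ν hα hβ.le (by linarith)
        (by linarith : 2 * α < 3 * α) hν0 (hM.sq_mul_exp_le_bind hb hβb (h3α.trans hR)))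
  · exact mul_log_add_log_le_of_mul_exp_neg_mul_pow_le_one hb (by positivity)
      (mul_div_pow_le_one_of_forall_le_measure_ball ν (by positivity) hα (by linarith)
        (hM.mul_exp_le_bind hDP hb hβb))
  · intro hε1
    have := mul_div_pow_le_one_of_forall_le_measure_ball ν (by positivity) hα hKα0
      (hM.mul_exp_mul_le_bind hε hε1 hDP hb hβb hKα0 hKα (hKα.trans hR))
    rw [hKdiv] at this
    exact mul_log_add_log_le_of_mul_exp_neg_mul_pow_le_one hb hK0 this
  · intro hε1
    exact log_one_div_le_of_mul_exp_neg_le hb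
      (le_of_forall_le_measure_ball_of_two_mul_lt hd ν hα hβ.le (by linarith)
        (by linarith : 2 * α < 3 * α) hν0
        (hM.mul_exp_mul_le_bind hε hε1 hDP hb hβb (by positivity) h3α (h3α.trans hR)))
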